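/- Let $f$ be analytic and univalent (injective) in the unit disk $\mathbb D=\{z\in\mathbb C:|z|<1\}$, normalized by $f(0)=0$, $f'(0)=1$ (that is, $f\in\mathcal S$), with expansion $f(z)=z+a_2z^2+a_3z^3+\cdots$, and suppose that $a_2=0$. Then the inverse function $f^{-1}:f(\mathbb D)\to\mathbb D$ is analytic in a neighbourhood of $0$, and if $f^{-1}(w)=w+A_2w^2+A_3w^3+\cdots$ denotes its expansion there, then the Hankel determinant $H_2(3)(f^{-1})=A_3A_5-A_4^2$ satisfies $$\left|A_3A_5-A_4^2\right|\le\frac{\sqrt3}{6\sqrt7}+2\sqrt3 .$$ -/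

import Mathlib

/-- The class `𝒮`: functions analytic and univalent (injective) in the open unit disk, normalized
by `f 0 = 0` and `f' 0 = 1`. -/
structure ClassS (f : ℂ → ℂ) : Prop where
  differentiableOn : DifferentiableOn ℂ f (Metric.ball 0 1)
  injOn : Set.InjOn f (Metric.ball 0 1)
  map_zero : f 0 = 0
  deriv_zero : deriv f 0 = 1

/-- The `n`-th Taylor coefficient of `f` at the origin. -/
noncomputable def taylorCoeff (f : ℂ → ℂ) (n : ℕ) : ℂ :=
  iteratedDeriv n f 0 / (n.factorial : ℂ)

/-- The inverse function of the restriction of `f` to the open unit disk: on the image of the disk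
it picks a preimage in the disk, which is unique when `f` is univalent; its values outside the
image are irrelevant. -/
noncomputable def diskInverse (f : ℂ → ℂ) : ℂ → ℂ :=
  Function.invFunOn f (Metric.ball 0 1)

/-- The Hankel determinant `H₂(3)(g) = a₃ a₅ - a₄²` of the Taylor coefficients of `g` at `0`. -/
noncomputable def hankelTwoThree (g : ℂ → ℂ) : ℂ :=
  taylorCoeff g 3 * taylorCoeff g 5 - taylorCoeff g 4 ^ 2

open Filter Topology MeasureTheory Real Set

/-! Since `a₂ = 0`, the reciprocal is `1/f = 1/z + b₁ z + b₂ z² + b₃ z³ + ⋯` with `b₁ = -a₃`, `b₂ =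
-a₄`, `b₃ = a₃² - a₅`, and the determinant equals `2 b₁³ + b₁ b₃ - b₂²`. The area theorem for `1/f`
(`area_inequality`) bounds `|b₁|² + 2|b₂|² + 3|b₃|²` by `1`, which gives at most `5/2 < 2√3`.

The area theorem is proved without Green's formula. Over `ε < |z| < r`, a partial Parseval sum
bounds the Dirichlet integral of `G = 1/f` from below (`circle_lintegral_deriv_sq_ge`). An upper
bound comes from the area of an image contained in a disk (`lintegral_deriv_sq_le`). The crude
radius `1/ε + O(ε)` would lose a constant in the area, so `G` is first composed with a real-linear
map that rounds the ellipse approximating the image of `|z| = ε`; the radius becomes `1/ε + O(ε²)`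
(`norm_add_mul_conj_le`). Then `ε → 0` and `r → 1`. -/

/-! ### Taylor coefficients and remainders. -/

/-- Taking `dslope` at the origin shifts the Taylor coefficients by one. -/
theorem taylorCoeff_succ {F : ℂ → ℂ} (hF : AnalyticAt ℂ F 0) (n : ℕ) :
    taylorCoeff F (n + 1) = taylorCoeff (dslope F 0) n := by
  have h1 := hF.hasFPowerSeriesAt.has_fpower_series_dslope_fslope
  have h2 := h1.eq_formalMultilinearSeries h1.analyticAt.hasFPowerSeriesAt
  have h3 := congrArg (fun p => p.coeff n) h2
  simpa [FormalMultilinearSeries.coeff_fslope, FormalMultilinearSeries.coeff_ofScalars,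
    taylorCoeff] using h3

/-- Taylor expansion at the origin with a remainder that inherits the regularity of the function. -/
theorem exists_taylor_remainder (U : Set ℂ) (hU : U ∈ 𝓝 (0 : ℂ)) (n : ℕ) :
    ∀ {F : ℂ → ℂ}, AnalyticAt ℂ F 0 → ∃ φ : ℂ → ℂ, AnalyticAt ℂ φ 0 ∧
      (DifferentiableOn ℂ F U → DifferentiableOn ℂ φ U) ∧
      ∀ z, F z = ∑ k ∈ Finset.range n, taylorCoeff F k * z ^ k + z ^ n * φ z := by
  induction n with
  | zero => intro F hF; exact ⟨F, hF, id, by simp⟩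
  | succ n ih =>
    intro F hF
    have hD : AnalyticAt ℂ (dslope F 0) 0 :=
      hF.hasFPowerSeriesAt.has_fpower_series_dslope_fslope.analyticAt
    obtain ⟨φ, hφ, hd, he⟩ := ih hD
    refine ⟨φ, hφ, fun h => hd ((Complex.differentiableOn_dslope hU).2 h), fun z => ?_⟩
    have h1 : F z = F 0 + z * dslope F 0 z := by
      have := sub_smul_dslope F 0 z
      simp only [sub_zero, smul_eq_mul] at this
      rw [this]; ring
    rw [h1, he z, Finset.sum_range_succ']
    simp only [taylorCoeff_succ hF]
    have h0 : taylorCoeff F 0 = F 0 := by simp [taylorCoeff]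
    rw [h0, mul_add, Finset.mul_sum]
    simp only [pow_succ, pow_zero]
    rw [Finset.sum_congr rfl (fun k _ => show z * (taylorCoeff (dslope F 0) k * z ^ k) =
      taylorCoeff (dslope F 0) k * (z ^ k * z) by ring)]
    ring

theorem taylorCoeff_zero (F : ℂ → ℂ) : taylorCoeff F 0 = F 0 := by simp [taylorCoeff]

theorem taylorCoeff_one (F : ℂ → ℂ) : taylorCoeff F 1 = deriv F 0 := by simp [taylorCoeff]

/-! ### Inverse and reciprocal of a univalent function. -/

theorem ClassS.analyticAt_zero {f : ℂ → ℂ} (hf : ClassS f) : AnalyticAt ℂ f 0 :=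
  hf.differentiableOn.analyticAt (Metric.ball_mem_nhds 0 one_pos)

theorem ClassS.diskInverse_apply {f : ℂ → ℂ} (hf : ClassS f) {z : ℂ}
    (hz : z ∈ Metric.ball (0 : ℂ) 1) : diskInverse f (f z) = z :=
  hf.injOn.leftInvOn_invFunOn hz

/-- As `f'(0) ≠ 0`, there is an analytic local inverse; any left inverse of `f` near `0` agrees with
it near `f 0 = 0`. -/
theorem ClassS.analyticAt_diskInverse {f : ℂ → ℂ} (hf : ClassS f) :
    AnalyticAt ℂ (diskInverse f) 0 := by
  have h0 : deriv f 0 ≠ 0 := by rw [hf.deriv_zero]; exact one_ne_zero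
  have ha := hf.analyticAt_zero.analyticAt_localInverse h0
  rw [hf.map_zero] at ha
  refine ha.congr ?_
  have := HasStrictFDerivAt.localInverse_unique
    (hf.analyticAt_zero.hasStrictDerivAt.hasStrictFDerivAt_equiv h0) (g := diskInverse f)
    (by filter_upwards [Metric.ball_mem_nhds (0 : ℂ) one_pos] with z hz
        exact hf.diskInverse_apply hz)
  rw [hf.map_zero] at this
  exact Filter.EventuallyEq.symm this

/-- Comparing constant terms: if `c + z χ(z)` vanishes near the origin, so do `c` and `χ`. -/
theorem eq_zero_of_add_mul_eventually_eq_zero {c : ℂ} {χ : ℂ → ℂ} (hχ : ContinuousAt χ 0)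
    (h : ∀ᶠ z in 𝓝[≠] (0 : ℂ), c + z * χ z = 0) :
    c = 0 ∧ ∀ᶠ z in 𝓝[≠] (0 : ℂ), χ z = 0 := by
  have hc : c = 0 := by
    have h1 : Tendsto (fun z => c + z * χ z) (𝓝[≠] (0 : ℂ)) (𝓝 (c + 0 * χ 0)) :=
      (ContinuousAt.tendsto (by fun_prop : ContinuousAt (fun z => c + z * χ z) 0)).mono_left
        nhdsWithin_le_nhds
    have h2 := tendsto_nhds_unique h1 (tendsto_const_nhds.congr' (h.mono fun z hz => hz.symm))
    simpa using h2
  refine ⟨hc, ?_⟩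
  filter_upwards [h, self_mem_nhdsWithin] with z hz hz0
  simpa [hc, show z ≠ 0 from hz0] using hz

/-- The first Taylor coefficients of the inverse of a function of class `𝒮` with `a₂ = 0`. -/
theorem ClassS.taylorCoeff_diskInverse {f : ℂ → ℂ} (hf : ClassS f) (ha : taylorCoeff f 2 = 0) :
    taylorCoeff (diskInverse f) 3 = -taylorCoeff f 3 ∧
    taylorCoeff (diskInverse f) 4 = -taylorCoeff f 4 ∧
    taylorCoeff (diskInverse f) 5 = 3 * taylorCoeff f 3 ^ 2 - taylorCoeff f 5 := by
  have hB := Metric.ball_mem_nhds (0 : ℂ) one_pos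
  obtain ⟨φ, hφ, -, hfe⟩ := exists_taylor_remainder _ hB 6 hf.analyticAt_zero
  obtain ⟨ψ, hψ, -, hge⟩ := exists_taylor_remainder _ hB 6 hf.analyticAt_diskInverse
  simp only [Finset.sum_range_succ, Finset.sum_range_zero, taylorCoeff_zero f, taylorCoeff_one f,
    hf.map_zero, hf.deriv_zero, ha] at hfe
  have hg0 : taylorCoeff (diskInverse f) 0 = 0 := by
    rw [taylorCoeff_zero]
    conv_lhs => rw [← hf.map_zero]
    exact hf.diskInverse_apply (by simp)
  simp only [Finset.sum_range_succ, Finset.sum_range_zero, hg0] at hge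
  set A1 := taylorCoeff (diskInverse f) 1
  set A2 := taylorCoeff (diskInverse f) 2
  set A3 := taylorCoeff (diskInverse f) 3
  set A4 := taylorCoeff (diskInverse f) 4
  set A5 := taylorCoeff (diskInverse f) 5
  set a3 := taylorCoeff f 3
  set a4 := taylorCoeff f 4
  set a5 := taylorCoeff f 5
  have hfc : ContinuousAt f 0 := hf.analyticAt_zero.continuousAt
  have hφc : ContinuousAt φ 0 := hφ.continuousAt
  have hψc : ContinuousAt (fun z => ψ (f z)) 0 :=
    ContinuousAt.comp (by rw [hf.map_zero]; exact hψ.continuousAt) hfc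
  -- `f z = z u`, `u = 1 + z ^ 2 v`, `v = a₃ + z s`, `s = a₄ + z p`
  let p : ℂ → ℂ := fun z => a5 + z * φ z
  let s : ℂ → ℂ := fun z => a4 + z * p z
  let v : ℂ → ℂ := fun z => a3 + z * s z
  let u : ℂ → ℂ := fun z => 1 + z ^ 2 * v z
  let χ : ℂ → ℂ := fun z => ψ (f z)
  have hp : ContinuousAt p 0 := by fun_prop
  have hs : ContinuousAt s 0 := by fun_prop
  have hv : ContinuousAt v 0 := by fun_prop
  have hu : ContinuousAt u 0 := by fun_prop
  have hχ : ContinuousAt χ 0 := hψc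
  have hfu : ∀ z, f z = z * u z := fun z => by rw [hfe z]; simp only [u, v, s, p]; ring
  have h0 : ∀ᶠ z in 𝓝[≠] (0 : ℂ), (A1 - 1) + z * (z * v z * A1 + u z ^ 2 * (A2 +
      z * u z * (A3 + z * u z * (A4 + z * u z * (A5 + z * u z * χ z))))) = 0 := by
    filter_upwards [nhdsWithin_le_nhds hB, self_mem_nhdsWithin] with z hz hz0
    have h1 := hge (f z)
    rw [hf.diskInverse_apply hz] at h1
    change z = _ + f z ^ 6 * χ z at h1
    rw [hfu z] at h1
    apply mul_left_cancel₀ (show z ≠ 0 from hz0)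
    rw [mul_zero, ← sub_eq_zero.2 h1.symm]
    simp only [u]; ring
  -- The identity `f⁻¹(f z) = z`, already divided by `z`, is peeled one power at a time: each `χ`
  -- below is what remains after removing the constant term and dividing by `z`.
  obtain ⟨hA1, h1⟩ := eq_zero_of_add_mul_eventually_eq_zero (by fun_prop) h0
  replace hA1 : A1 = 1 := sub_eq_zero.1 hA1
  obtain ⟨hA2, h2⟩ := eq_zero_of_add_mul_eventually_eq_zero (c := A2)
    (χ := fun z => v z + z * (2 + z ^ 2 * v z) * v z * A2 +
      u z ^ 3 * (A3 + z * u z * (A4 + z * u z * (A5 + z * u z * χ z)))) (by fun_prop)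
    (h1.mono fun z hz => by rw [← hz, hA1]; simp only [u]; ring)
  obtain ⟨hA3, h3⟩ := eq_zero_of_add_mul_eventually_eq_zero (c := a3 + A3)
    (χ := fun z => s z + z * (3 + 3 * z ^ 2 * v z + z ^ 4 * v z ^ 2) * v z * A3 +
      u z ^ 4 * (A4 + z * u z * (A5 + z * u z * χ z))) (by fun_prop)
    (h2.mono fun z hz => by
      rw [← hz, hA2]
      have hvz : v z = a3 + z * s z := rfl
      have : u z ^ 3 * A3 = A3 + z * (z * (3 + 3 * z ^ 2 * v z + z ^ 4 * v z ^ 2) * v z * A3) := by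
        simp only [u]; ring
      linear_combination -this - hvz)
  obtain ⟨hA4, h4⟩ := eq_zero_of_add_mul_eventually_eq_zero (c := a4 + A4)
    (χ := fun z => p z + (3 + 3 * z ^ 2 * v z + z ^ 4 * v z ^ 2) * v z * A3 +
      z * v z * (4 + 6 * z ^ 2 * v z + 4 * z ^ 4 * v z ^ 2 + z ^ 6 * v z ^ 3) * A4 +
      u z ^ 5 * (A5 + z * u z * χ z)) (by fun_prop)
    (h3.mono fun z hz => by
      rw [← hz]
      have hsz : s z = a4 + z * p z := rfl
      have : u z ^ 4 * A4 = A4 + z * (z * v z *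
          (4 + 6 * z ^ 2 * v z + 4 * z ^ 4 * v z ^ 2 + z ^ 6 * v z ^ 3) * A4) := by
        simp only [u]; ring
      linear_combination -this - hsz)
  have hA5 : a5 + 3 * a3 * A3 + A5 = 0 := by
    have hcont : ContinuousAt (fun z => p z + (3 + 3 * z ^ 2 * v z + z ^ 4 * v z ^ 2) * v z * A3 +
      z * v z * (4 + 6 * z ^ 2 * v z + 4 * z ^ 4 * v z ^ 2 + z ^ 6 * v z ^ 3) * A4 +
      u z ^ 5 * (A5 + z * u z * χ z)) 0 := by fun_prop
    have := tendsto_nhds_unique (hcont.tendsto.mono_left nhdsWithin_le_nhds)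
      (tendsto_const_nhds.congr' (h4.mono fun z hz => hz.symm))
    simpa [p, v, u] using this
  refine ⟨by linear_combination hA3, by linear_combination hA4, ?_⟩
  linear_combination hA5 - 3 * a3 * hA3

/-- The reciprocal of a function of class `𝒮` with `a₂ = 0`. -/
theorem ClassS.exists_inv_expansion {f : ℂ → ℂ} (hf : ClassS f) (ha : taylorCoeff f 2 = 0) :
    ∃ k : ℂ → ℂ, DifferentiableOn ℂ k (Metric.ball 0 1) ∧
      ∀ z ∈ Metric.ball (0 : ℂ) 1, z ≠ 0 → (f z)⁻¹ = z⁻¹ + (-taylorCoeff f 3) * z +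
        (-taylorCoeff f 4) * z ^ 2 + (taylorCoeff f 3 ^ 2 - taylorCoeff f 5) * z ^ 3 +
        z ^ 4 * k z := by
  have hB := Metric.ball_mem_nhds (0 : ℂ) one_pos
  obtain ⟨φ, -, hφ, hfe⟩ := exists_taylor_remainder _ hB 6 hf.analyticAt_zero
  replace hφ := hφ hf.differentiableOn
  simp only [Finset.sum_range_succ, Finset.sum_range_zero, taylorCoeff_zero f, taylorCoeff_one f,
    hf.map_zero, hf.deriv_zero, ha] at hfe
  set a3 := taylorCoeff f 3
  set a4 := taylorCoeff f 4
  set a5 := taylorCoeff f 5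
  let w : ℂ → ℂ := fun z => a4 + a5 * z + z ^ 2 * φ z
  let v : ℂ → ℂ := fun z => a3 + z * w z
  let u : ℂ → ℂ := fun z => 1 + z ^ 2 * v z
  have hw : DifferentiableOn ℂ w (Metric.ball 0 1) := by fun_prop
  have hv : DifferentiableOn ℂ v (Metric.ball 0 1) := by fun_prop
  have hu : DifferentiableOn ℂ u (Metric.ball 0 1) := by fun_prop
  have hfu : ∀ z, f z = z * u z := fun z => by rw [hfe z]; simp only [u, v, w]; ring
  have hu0 : ∀ z ∈ Metric.ball (0 : ℂ) 1, u z ≠ 0 := by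
    intro z hz h
    have h1 : f z = f 0 := by rw [hfu, h, mul_zero, hf.map_zero]
    have h2 : z = 0 := hf.injOn hz (by simp) h1
    simp [u, h2] at h
  -- The numerator is `1 - u (1 + b₁ z² + b₂ z³ + b₃ z⁴)` divided by `z⁵`; injectivity of `f` keeps
  -- `u` free of zeros.
  refine ⟨fun z => (a3 * w z + v z * (a4 + (a5 - a3 ^ 2) * z) - φ z) / u z,
    DifferentiableOn.div (by fun_prop) hu hu0, fun z hz hz0 => ?_⟩
  have := hu0 z hz
  rw [hfu]
  field_simp
  simp only [u, v, w]
  ring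

/-! ### Circle means and Dirichlet integrals. -/

/-- The determinant of the real-linear map `w ↦ a w + b w̄`. -/
theorem det_mul_add_mul_conj (a b : ℂ) :
    (a • ContinuousLinearMap.id ℝ ℂ + b • (Complex.conjCLE : ℂ →L[ℝ] ℂ)).det =
      ‖a‖ ^ 2 - ‖b‖ ^ 2 := by
  rw [ContinuousLinearMap.det, ← LinearMap.det_toMatrix Complex.basisOneI, Matrix.det_fin_two]
  simp [LinearMap.toMatrix_apply, Complex.sq_norm, Complex.normSq_apply]
  ring

/-- The mean value property for the real part of a holomorphic function, in polar coordinates. -/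
theorem circle_average_re {Φ : ℂ → ℂ} {U : Set ℂ} (hΦ : DifferentiableOn ℂ Φ U)
    {t : ℝ} (ht : 0 < t) (htU : Metric.closedBall 0 t ⊆ U) :
    ∫ θ in Ioo (-π) π, (Φ (Complex.polarCoord.symm (t, θ))).re = 2 * π * (Φ 0).re := by
  have h1 : circleAverage Φ 0 t = Φ 0 := by
    apply DiffContOnCl.circleAverage
    rw [abs_of_pos ht]
    refine (hΦ.mono ?_).diffContOnCl
    rw [closure_ball _ ht.ne']; exact htU
  have hc : ContinuousOn Φ (Metric.sphere 0 t) :=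
    hΦ.continuousOn.mono (Metric.sphere_subset_closedBall.trans htU)
  have hcont : Continuous fun θ : ℝ => Φ (circleMap 0 t θ) :=
    hc.comp_continuous (continuous_circleMap 0 t) fun θ => circleMap_mem_sphere 0 ht.le θ
  have hsymm : ∀ θ : ℝ, Complex.polarCoord.symm (t, θ) = circleMap 0 t θ := by
    intro θ
    rw [Complex.polarCoord_symm_apply, circleMap, Complex.exp_mul_I]
    simp
  simp only [hsymm]
  rw [← integral_Ioc_eq_integral_Ioo, ← intervalIntegral.integral_of_le (by linarith [pi_pos])]
  have hper : Function.Periodic (fun θ : ℝ => (Φ (circleMap 0 t θ)).re) (2 * π) := fun θ => by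
    simp only [periodic_circleMap 0 t θ]
  have h2 := hper.intervalIntegral_add_eq (-π) 0
  rw [show -π + 2 * π = π by ring, zero_add] at h2
  rw [h2]
  have h3 := congrArg Complex.re h1
  rw [circleAverage, Complex.smul_re, smul_eq_mul] at h3
  have h4 : (∫ θ in (0 : ℝ)..2 * π, Φ (circleMap 0 t θ)).re =
      ∫ θ in (0 : ℝ)..2 * π, (Φ (circleMap 0 t θ)).re :=
    (Complex.reCLM.intervalIntegral_comp_comm (hcont.intervalIntegrable _ _)).symm
  rw [h4] at h3
  rw [← h3]
  field_simp

/-- A circle mean of a function that dominates the real part of a holomorphic one. -/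
theorem circle_lintegral_ge {Φ : ℂ → ℂ} (hΦ : DifferentiableOn ℂ Φ (Metric.ball 0 1))
    (hΦ0 : Φ 0 = 0) {J : ℂ → ℝ} (hJ : ∀ z, 0 ≤ J z) {t c : ℝ} (ht : 0 < t) (ht1 : t < 1)
    (hkey : ∀ z : ℂ, ‖z‖ = t → c + 2 * (Φ z).re ≤ J z) :
    ENNReal.ofReal (2 * π * c) ≤
      ∫⁻ θ in Ioo (-π) π, ENNReal.ofReal (J (Complex.polarCoord.symm (t, θ))) := by
  have hsub : Metric.closedBall (0 : ℂ) t ⊆ Metric.ball 0 1 :=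
    Metric.closedBall_subset_ball ht1
  have hnorm : ∀ θ : ℝ, ‖Complex.polarCoord.symm (t, θ)‖ = t := fun θ => by
    simp [abs_of_pos ht]
  have hcontP : Continuous fun θ : ℝ => Complex.polarCoord.symm (t, θ) := by
    simp only [Complex.polarCoord_symm_apply]; fun_prop
  have hcΦ : Continuous fun θ : ℝ => Φ (Complex.polarCoord.symm (t, θ)) :=
    hΦ.continuousOn.comp_continuous hcontP fun θ => by simp [abs_of_pos ht, ht1]
  have hre : Continuous fun θ : ℝ => (Φ (Complex.polarCoord.symm (t, θ))).re :=
    Complex.continuous_re.comp hcΦ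
  have hi : IntegrableOn (fun θ : ℝ => c + 2 * (Φ (Complex.polarCoord.symm (t, θ))).re)
      (Ioo (-π) π) :=
    (continuous_const.add (continuous_const.mul hre)).integrableOn_Icc.mono_set Ioo_subset_Icc_self
  have hi2 : IntegrableOn (fun θ : ℝ => (Φ (Complex.polarCoord.symm (t, θ))).re)
      (Ioo (-π) π) :=
    hre.integrableOn_Icc.mono_set Ioo_subset_Icc_self
  have hint : ∫ θ in Ioo (-π) π, (c + 2 * (Φ (Complex.polarCoord.symm (t, θ))).re) =
      2 * π * c := by
    rw [integral_add (integrable_const _) (hi2.const_mul 2), integral_const_mul,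
      circle_average_re hΦ ht hsub, hΦ0]
    simp only [integral_const, MeasurableSet.univ, measureReal_restrict_apply, univ_inter,
      volume_real_Ioo, smul_eq_mul, Complex.zero_re, mul_zero, add_zero]
    rw [max_eq_left (by linarith [pi_pos])]
    ring
  rw [← hint]
  -- The minorant may be negative, so it is replaced by its positive part before passing to `∫⁻`.
  calc ENNReal.ofReal (∫ θ in Ioo (-π) π, (c + 2 * (Φ (Complex.polarCoord.symm (t, θ))).re))
      ≤ ENNReal.ofReal (∫ θ in Ioo (-π) π,
          max (c + 2 * (Φ (Complex.polarCoord.symm (t, θ))).re) 0) :=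
        ENNReal.ofReal_le_ofReal (integral_mono hi hi.pos_part fun θ => le_max_left _ _)
    _ = ∫⁻ θ in Ioo (-π) π,
          ENNReal.ofReal (max (c + 2 * (Φ (Complex.polarCoord.symm (t, θ))).re) 0) :=
        ofReal_integral_eq_lintegral_ofReal hi.pos_part
          (Eventually.of_forall fun θ => le_max_right _ _)
    _ ≤ _ := lintegral_mono fun θ => ENNReal.ofReal_le_ofReal
        (max_le (hkey _ (hnorm θ)) (hJ _))

/-- If `G = 1/z + b₁ z + b₂ z² + b₃ z³ + z⁴ k`, the mean of `|G'|²` over a circle dominates the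
partial Parseval sum. -/
theorem circle_lintegral_deriv_sq_ge {g q : ℂ → ℂ} {b₁ b₂ b₃ : ℂ}
    (hq : DifferentiableOn ℂ q (Metric.ball 0 1))
    (hg : ∀ z ∈ Metric.ball (0 : ℂ) 1, z ≠ 0 →
      g z = -(z ^ 2)⁻¹ + (b₁ + 2 * b₂ * z + 3 * b₃ * z ^ 2 + z ^ 3 * q z))
    {t : ℝ} (ht : 0 < t) (ht1 : t < 1) :
    ENNReal.ofReal (2 * π * ((t ^ 4)⁻¹ + ‖b₁‖ ^ 2 + 4 * ‖b₂‖ ^ 2 * t ^ 2 + 9 * ‖b₃‖ ^ 2 * t ^ 4)) ≤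
      ∫⁻ θ in Ioo (-π) π, ENNReal.ofReal (‖g (Complex.polarCoord.symm (t, θ))‖ ^ 2) := by
  let conj := starRingEnd ℂ
  -- On `|z| = t` one has `z̄ = t²/z`, so the cross terms of `|g|²` pair up as `Φ + Φ̄` with `Φ`
  -- holomorphic and vanishing at `0`; they average to zero.
  let Φ : ℂ → ℂ := fun z =>
    -((t : ℂ) ^ 4)⁻¹ * z ^ 2 * (b₁ + 2 * b₂ * z + 3 * b₃ * z ^ 2 + z ^ 3 * q z) +
    (conj b₁ * (2 * b₂ * z + 3 * b₃ * z ^ 2) + 2 * conj b₂ * 3 * b₃ * (t : ℂ) ^ 2 * z) +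
    (conj b₁ * z ^ 3 + 2 * conj b₂ * (t : ℂ) ^ 2 * z ^ 2 + 3 * conj b₃ * (t : ℂ) ^ 4 * z) * q z
  have hΦ : DifferentiableOn ℂ Φ (Metric.ball 0 1) := by fun_prop
  have hΦ0 : Φ 0 = 0 := by simp [Φ]
  let c : ℝ := (t ^ 4)⁻¹ + ‖b₁‖ ^ 2 + 4 * ‖b₂‖ ^ 2 * t ^ 2 + 9 * ‖b₃‖ ^ 2 * t ^ 4
  refine circle_lintegral_ge hΦ hΦ0 (J := fun z => ‖g z‖ ^ 2) (fun z => sq_nonneg _) ht ht1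
    (c := c) fun z hz => ?_
  have hz0 : z ≠ 0 := by rintro rfl; simp at hz; linarith
  have hzc : z * conj z = (t : ℂ) ^ 2 := by rw [Complex.mul_conj, ← hz, Complex.normSq_eq_norm_sq]; simp
  have htc : (t : ℂ) ≠ 0 := by exact_mod_cast ht.ne'
  have hcz : conj z = (t : ℂ) ^ 2 / z := by field_simp; linear_combination hzc
  rw [hg z (by simp [hz, ht1]) hz0]
  have hn : ∀ w : ℂ, ((‖w‖ ^ 2 : ℝ) : ℂ) = w * conj w := fun w => by
    rw [Complex.mul_conj, Complex.normSq_eq_norm_sq]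
  have e : ((‖-(z ^ 2)⁻¹ + (b₁ + 2 * b₂ * z + 3 * b₃ * z ^ 2 + z ^ 3 * q z)‖ ^ 2 : ℝ) : ℂ) =
      ((c + ‖z ^ 3 * q z‖ ^ 2 : ℝ) : ℂ) + (Φ z + conj (Φ z)) := by
    simp only [c, Φ, Complex.ofReal_add, Complex.ofReal_mul, hn, Complex.ofReal_inv,
      Complex.ofReal_pow, map_add, map_mul, map_neg, map_inv₀, map_pow, Complex.conj_ofReal, conj,
      Complex.conj_conj, map_ofNat, Complex.ofReal_ofNat]
    rw [show (starRingEnd ℂ) z = (t : ℂ) ^ 2 / z from hcz]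
    field_simp
    ring
  rw [Complex.add_conj] at e
  have e2 : ‖-(z ^ 2)⁻¹ + (b₁ + 2 * b₂ * z + 3 * b₃ * z ^ 2 + z ^ 3 * q z)‖ ^ 2 =
      c + ‖z ^ 3 * q z‖ ^ 2 + 2 * (Φ z).re := by exact_mod_cast e
  rw [e2]; nlinarith [sq_nonneg ‖z ^ 3 * q z‖]

/-- A lower bound for the Dirichlet integral over an annulus from lower bounds for circle means. -/
theorem annulus_lintegral_ge {J : ℂ → ℝ} (hJ : Measurable J) {ε r : ℝ} (hε : 0 < ε) {c : ℝ → ℝ}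
    (hc : ∀ t ∈ Ioo ε r, ENNReal.ofReal (c t) ≤
      ∫⁻ θ in Ioo (-π) π, ENNReal.ofReal (J (Complex.polarCoord.symm (t, θ)))) :
    ∫⁻ t in Ioo ε r, ENNReal.ofReal (t * c t) ≤
      ∫⁻ z in {z : ℂ | ε < ‖z‖ ∧ ‖z‖ < r}, ENNReal.ofReal (J z) := by
  let A := {z : ℂ | ε < ‖z‖ ∧ ‖z‖ < r}
  have hA : MeasurableSet A := by
    apply MeasurableSet.inter
    · exact measurableSet_lt measurable_const measurable_norm
    · exact measurableSet_lt measurable_norm measurable_const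
  have hP : Measurable fun p : ℝ × ℝ => Complex.polarCoord.symm p := by
    simp only [Complex.polarCoord_symm_apply]; fun_prop
  have hm : Measurable (A.indicator fun z => ENNReal.ofReal (J z)) :=
    (ENNReal.measurable_ofReal.comp hJ).indicator hA
  change _ ≤ ∫⁻ z in A, _
  rw [← lintegral_indicator hA, ← Complex.lintegral_comp_polarCoord_symm, polarCoord_target,
    Measure.volume_eq_prod, setLIntegral_prod _
      (Measurable.aemeasurable (by exact (ENNReal.measurable_ofReal.comp measurable_fst).smul (hm.comp hP)))]
  refine le_trans ?_ (lintegral_mono_set (s := Ioo ε r) fun t ht => hε.trans ht.1)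
  refine setLIntegral_mono' measurableSet_Ioo fun t ht => ?_
  have ht0 : 0 < t := hε.trans ht.1
  rw [ENNReal.ofReal_mul ht0.le]
  have : ∀ θ : ℝ, A.indicator (fun z => ENNReal.ofReal (J z)) (Complex.polarCoord.symm (t, θ)) =
      ENNReal.ofReal (J (Complex.polarCoord.symm (t, θ))) := fun θ =>
    indicator_of_mem (by simpa [A, abs_of_pos ht0] using ht) _
  simp only [this, smul_eq_mul]
  rw [lintegral_const_mul' _ _ ENNReal.ofReal_ne_top]
  gcongr
  exact hc t ht

/-- The radial integral that arises in the area theorem. -/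
theorem lintegral_radial {ε r β₁ β₂ β₃ : ℝ} (hε : 0 < ε) (hr : ε ≤ r)
    (h₁ : 0 ≤ β₁) (h₂ : 0 ≤ β₂) (h₃ : 0 ≤ β₃) :
    ∫⁻ t in Ioo ε r, ENNReal.ofReal
      (t * (2 * π * ((t ^ 4)⁻¹ + β₁ + 4 * β₂ * t ^ 2 + 9 * β₃ * t ^ 4))) =
    ENNReal.ofReal (π * ((ε ^ 2)⁻¹ - (r ^ 2)⁻¹ + β₁ * (r ^ 2 - ε ^ 2) + 2 * β₂ * (r ^ 4 - ε ^ 4) +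
      3 * β₃ * (r ^ 6 - ε ^ 6))) := by
  have hcont : ContinuousOn
      (fun t : ℝ => t * (2 * π * ((t ^ 4)⁻¹ + β₁ + 4 * β₂ * t ^ 2 + 9 * β₃ * t ^ 4))) (Icc ε r) := by
    have : ∀ t ∈ Icc ε r, t ^ 4 ≠ 0 := fun t ht => by have := hε.trans_le ht.1; positivity
    fun_prop (disch := assumption)
  have hi := hcont.integrableOn_Icc (μ := volume)
  rw [← ofReal_integral_eq_lintegral_ofReal (hi.mono_set Ioo_subset_Icc_self)]
  · congr 1
    rw [← integral_Ioc_eq_integral_Ioo, ← intervalIntegral.integral_of_le hr,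
      intervalIntegral.integral_eq_sub_of_hasDerivAt (f := fun t => π * (-(t ^ 2)⁻¹ + β₁ * t ^ 2 +
        2 * β₂ * t ^ 4 + 3 * β₃ * t ^ 6))]
    · ring
    · intro t ht
      rw [uIcc_of_le hr] at ht
      have ht0 : t ≠ 0 := (hε.trans_le ht.1).ne'
      have h := ((((((hasDerivAt_pow 2 t).inv (by positivity)).neg).add
        ((hasDerivAt_pow 2 t).const_mul β₁)).add ((hasDerivAt_pow 4 t).const_mul (2 * β₂))).add
        ((hasDerivAt_pow 6 t).const_mul (3 * β₃))).const_mul π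
      refine HasDerivAt.congr_deriv (h.congr_of_eventuallyEq (Eventually.of_forall fun s => by simp)) ?_
      field_simp
      push_cast
      ring
    · rw [intervalIntegrable_iff_integrableOn_Icc_of_le hr]; exact hi
  · refine (ae_restrict_iff' measurableSet_Ioo).2 (Eventually.of_forall fun t ht => ?_)
    have := hε.trans ht.1
    simp only [Pi.zero_apply]
    positivity

/-- If `G + β Ḡ` maps a measurable set into a disk of radius `ρ`, with `G` injective and
holomorphic and `|β| < 1`, the Dirichlet integral of `G` is controlled by `ρ`. -/
theorem lintegral_deriv_sq_le {G : ℂ → ℂ} {A : Set ℂ} (hA : MeasurableSet A)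
    (hG : ∀ z ∈ A, DifferentiableAt ℂ G z) (hinj : InjOn G A) {β : ℂ} (hβ : ‖β‖ < 1) {ρ : ℝ}
    (hρ : 0 ≤ ρ)
    (hball : ∀ z ∈ A, ‖G z + β * starRingEnd ℂ (G z)‖ ≤ ρ) :
    ENNReal.ofReal (1 - ‖β‖ ^ 2) * ∫⁻ z in A, ENNReal.ofReal (‖deriv G z‖ ^ 2) ≤
      ENNReal.ofReal (π * ρ ^ 2) := by
  let H : ℂ → ℂ := fun z => G z + β * starRingEnd ℂ (G z)
  have hder : ∀ z ∈ A, HasFDerivWithinAt H (deriv G z • ContinuousLinearMap.id ℝ ℂ +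
      (β * starRingEnd ℂ (deriv G z)) • (Complex.conjCLE : ℂ →L[ℝ] ℂ)) A z := by
    intro z hz
    have h1 : HasFDerivAt G (deriv G z • ContinuousLinearMap.id ℝ ℂ) z := by
      have := (hG z hz).hasDerivAt.hasFDerivAt.restrictScalars ℝ
      refine this.congr_fderiv ?_
      ext; simp [mul_comm]
    have h2 : HasFDerivAt (fun z => β * starRingEnd ℂ (G z))
        (β • ((Complex.conjCLE : ℂ →L[ℝ] ℂ).comp (deriv G z • ContinuousLinearMap.id ℝ ℂ))) z :=
      (((Complex.conjCLE : ℂ →L[ℝ] ℂ).hasFDerivAt).comp z h1).const_mul β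
    refine HasFDerivAt.hasFDerivWithinAt ((h1.add h2).congr_fderiv ?_)
    ext; simp [mul_assoc]
  have hinjH : InjOn H A := by
    intro x hx y hy hxy
    apply hinj hx hy
    have h1 : G x - G y = -(β * starRingEnd ℂ (G x - G y)) := by
      simp only [H] at hxy; rw [map_sub]; linear_combination hxy
    have h2 := congrArg norm h1
    rw [norm_neg, norm_mul, RCLike.norm_conj] at h2
    have h3 : ‖G x - G y‖ = 0 := by
      have := norm_nonneg (G x - G y)
      nlinarith
    exact sub_eq_zero.1 (norm_eq_zero.1 h3)
  -- Change of variables: the Jacobian of `H` is `(1 - |β|²)|G'|²`.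
  have hcv := lintegral_image_eq_lintegral_abs_det_fderiv_mul volume hA hder hinjH (fun _ => 1)
  simp only [lintegral_const, one_mul, mul_one, MeasurableSet.univ, Measure.restrict_apply,
    univ_inter, det_mul_add_mul_conj] at hcv
  have hβ2 : 0 ≤ 1 - ‖β‖ ^ 2 := by nlinarith [norm_nonneg β]
  rw [← lintegral_const_mul' _ _ ENNReal.ofReal_ne_top]
  calc _ = ∫⁻ z in A, ENNReal.ofReal |‖deriv G z‖ ^ 2 - ‖β * starRingEnd ℂ (deriv G z)‖ ^ 2| := by
        refine lintegral_congr fun z => ?_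
        rw [← ENNReal.ofReal_mul hβ2, norm_mul, RCLike.norm_conj,
          show ‖deriv G z‖ ^ 2 - (‖β‖ * ‖deriv G z‖) ^ 2 = (1 - ‖β‖ ^ 2) * ‖deriv G z‖ ^ 2 by ring,
          abs_of_nonneg (by positivity)]
    _ = volume (H '' A) := hcv.symm
    _ ≤ volume (Metric.closedBall (0 : ℂ) ρ) := measure_mono (by
        rintro _ ⟨z, hz, rfl⟩; simpa using hball z hz)
    _ = ENNReal.ofReal (π * ρ ^ 2) := by
        rw [Complex.volume_closedBall, mul_comm, ENNReal.ofReal_mul pi_pos.le,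
          ENNReal.ofReal_pow hρ]
        congr 1
        rw [← NNReal.coe_real_pi, ENNReal.ofReal_coe_nnreal]

/-! ### Size of the corrected image of the annulus. -/

/-- With `s = |z|`, the left side is the triangle-inequality bound for the corrected map. The `B`
term of order `s` vanishes at `s = ε`, which is why the excess over `1/ε` is only `O(ε²)`. -/
theorem inv_add_le_inv_add {ε s B K : ℝ} (hε : 0 < ε) (hε1 : ε ≤ 1) (hB : 0 ≤ B) (hK : 0 ≤ K)
    (h₁ : 3 * B * ε ≤ 1) (h₂ : 2 * (B + K + B * (B + K)) * ε ≤ 1) (hs : ε < s) (hs1 : s ≤ 1) :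
    s⁻¹ + B * (s * (1 - ε ^ 2 / s ^ 2)) + K * s ^ 2 + B * ε ^ 2 * (B * s + K * s ^ 2) ≤
      ε⁻¹ + (4 * K + B * (B + K)) * ε ^ 2 := by
  have hs0 : 0 < s := hε.trans hs
  have hs2 : s ^ 2 ≤ 1 := by nlinarith
  have hε2 : ε ^ 2 ≤ 1 := by nlinarith
  have hlast : B * s + K * s ^ 2 ≤ B + K := by nlinarith
  -- For `s ≤ 2ε` the drop `1/ε - 1/s` absorbs the linear term; for `s ≥ 2ε` a spare `1/(2ε)`
  -- absorbs all bounded terms.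
  rcases le_total s (2 * ε) with h | h
  · have e1 : ε⁻¹ - s⁻¹ - B * (s * (1 - ε ^ 2 / s ^ 2)) =
        (s - ε) / (ε * s) * (1 - B * ε * (s + ε)) := by
      field_simp; ring
    have e2 : 0 ≤ (s - ε) / (ε * s) * (1 - B * ε * (s + ε)) := by
      refine mul_nonneg (div_nonneg (by linarith) (by positivity)) ?_
      have : B * ε * (s + ε) ≤ B * ε * 3 := by gcongr; linarith
      linarith
    have e3 : K * s ^ 2 ≤ K * (2 * ε) ^ 2 := by gcongr
    have e4 : B * ε ^ 2 * (B * s + K * s ^ 2) ≤ B * ε ^ 2 * (B + K) := by gcongr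
    nlinarith
  · have e1 : s⁻¹ ≤ (2 * ε)⁻¹ := by gcongr
    have e2 : B * (s * (1 - ε ^ 2 / s ^ 2)) ≤ B := by
      have h0 : 0 ≤ s * (ε ^ 2 / s ^ 2) := by positivity
      have : s * (1 - ε ^ 2 / s ^ 2) ≤ 1 := by linarith
      nlinarith
    have e3 : K * s ^ 2 ≤ K := by nlinarith
    have e4 : B * ε ^ 2 * (B * s + K * s ^ 2) ≤ B * 1 * (B + K) := by gcongr
    have e5 : B + K + B * (B + K) ≤ (2 * ε)⁻¹ := by
      rw [← one_div, le_div_iff₀ (by positivity)]; linarith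
    have e6 : (2 * ε)⁻¹ + (2 * ε)⁻¹ = ε⁻¹ := by field_simp; ring
    have : 0 ≤ (4 * K + B * (B + K)) * ε ^ 2 := by positivity
    linarith

/-- The choice `β = -b₁ ε²` makes `β` times the conjugate of `1/z` equal to `-b₁ z` on `|z| = ε`,
cancelling the linear term of `G` there. -/
theorem norm_add_mul_conj_le {G m : ℂ → ℂ} {b₁ : ℂ} {ε r K : ℝ} (hr1 : r ≤ 1)
    (hG : ∀ z ∈ Metric.ball (0 : ℂ) 1, z ≠ 0 → G z = z⁻¹ + b₁ * z + z ^ 2 * m z)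
    (hm : ∀ z ∈ Metric.closedBall (0 : ℂ) r, ‖m z‖ ≤ K)
    (hε : 0 < ε) (hε1 : ε ≤ 1) (hK : 0 ≤ K)
    (h₁ : 3 * ‖b₁‖ * ε ≤ 1) (h₂ : 2 * (‖b₁‖ + K + ‖b₁‖ * (‖b₁‖ + K)) * ε ≤ 1)
    {z : ℂ} (hz : ε < ‖z‖) (hzr : ‖z‖ < r) :
    ‖G z + (-b₁ * (ε : ℂ) ^ 2) * starRingEnd ℂ (G z)‖ ≤
      ε⁻¹ + (4 * K + ‖b₁‖ * (‖b₁‖ + K)) * ε ^ 2 := by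
  have hz0 : z ≠ 0 := norm_pos_iff.1 (hε.trans hz)
  have hs0 : 0 < ‖z‖ := hε.trans hz
  have hsC : (‖z‖ : ℂ) ≠ 0 := by exact_mod_cast hs0.ne'
  have hcz : starRingEnd ℂ z = (‖z‖ : ℂ) ^ 2 / z := by
    rw [eq_div_iff hz0, mul_comm, Complex.mul_conj, Complex.normSq_eq_norm_sq]; simp
  have hmz := hm z (by simpa using hzr.le)
  refine le_trans ?_ (inv_add_le_inv_add hε hε1 (norm_nonneg b₁) hK h₁ h₂ hz (hzr.le.trans hr1))
  have e : G z + (-b₁ * (ε : ℂ) ^ 2) * starRingEnd ℂ (G z) =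
      z⁻¹ + b₁ * (z * ((1 - ε ^ 2 / ‖z‖ ^ 2 : ℝ) : ℂ)) + m z * z ^ 2 +
        -(b₁ * (ε : ℂ) ^ 2 * starRingEnd ℂ (b₁ * z + m z * z ^ 2)) := by
    rw [hG z (by simpa using hzr.trans_le hr1) hz0]
    simp only [map_add, map_inv₀]
    rw [hcz]
    push_cast
    field_simp
    ring
  have hnn : 0 ≤ 1 - ε ^ 2 / ‖z‖ ^ 2 := by
    rw [sub_nonneg, div_le_one (by positivity)]; gcongr
  rw [e]
  refine (norm_add_le _ _).trans (add_le_add ((norm_add_le _ _).trans (add_le_add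
    ((norm_add_le _ _).trans (add_le_add ?_ ?_)) ?_)) ?_)
  · rw [norm_inv]
  · rw [norm_mul, norm_mul, Complex.norm_real, Real.norm_of_nonneg hnn]
  · rw [norm_mul, norm_pow]; gcongr
  · rw [norm_neg, norm_mul, norm_mul, RCLike.norm_conj, norm_pow, Complex.norm_real,
      Real.norm_of_nonneg hε.le]
    gcongr
    refine (norm_add_le _ _).trans ?_
    rw [norm_mul, norm_mul, norm_pow]
    gcongr

/-! ### The area theorem. -/

/-- The area inequality before passing to the limit. -/
theorem area_inequality_annulus {G k : ℂ → ℂ} {b₁ b₂ b₃ : ℂ}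
    (hk : DifferentiableOn ℂ k (Metric.ball 0 1))
    (hG : ∀ z ∈ Metric.ball (0 : ℂ) 1, z ≠ 0 →
      G z = z⁻¹ + b₁ * z + b₂ * z ^ 2 + b₃ * z ^ 3 + z ^ 4 * k z)
    (hinj : InjOn G (Metric.ball 0 1 \ {0})) {ε r ρ : ℝ} (hε : 0 < ε) (hεr : ε ≤ r) (hr1 : r ≤ 1)
    {β : ℂ} (hβ : ‖β‖ < 1) (hρ : 0 ≤ ρ)
    (hball : ∀ z : ℂ, ε < ‖z‖ → ‖z‖ < r → ‖G z + β * starRingEnd ℂ (G z)‖ ≤ ρ) :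
    (1 - ‖β‖ ^ 2) * ((ε ^ 2)⁻¹ - (r ^ 2)⁻¹ + ‖b₁‖ ^ 2 * (r ^ 2 - ε ^ 2) +
      2 * ‖b₂‖ ^ 2 * (r ^ 4 - ε ^ 4) + 3 * ‖b₃‖ ^ 2 * (r ^ 6 - ε ^ 6)) ≤ ρ ^ 2 := by
  let A := {z : ℂ | ε < ‖z‖ ∧ ‖z‖ < r}
  have hA : MeasurableSet A :=
    (measurableSet_lt measurable_const measurable_norm).inter
      (measurableSet_lt measurable_norm measurable_const)
  have hball1 : ∀ z : ℂ, ‖z‖ < 1 → z ∈ Metric.ball (0 : ℂ) 1 := fun z hz => by simpa using hz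
  let h : ℂ → ℂ := fun z => z⁻¹ + b₁ * z + b₂ * z ^ 2 + b₃ * z ^ 3 + z ^ 4 * k z
  have hder : ∀ z ∈ Metric.ball (0 : ℂ) 1, z ≠ 0 → HasDerivAt G (-(z ^ 2)⁻¹ +
      (b₁ + 2 * b₂ * z + 3 * b₃ * z ^ 2 + z ^ 3 * (4 * k z + z * deriv k z))) z := by
    intro z hz hz0
    have hkz : HasDerivAt k (deriv k z) z :=
      (hk.differentiableAt (Metric.isOpen_ball.mem_nhds hz)).hasDerivAt
    have h1 : HasDerivAt h _ z :=
      (((((hasDerivAt_inv hz0).add ((hasDerivAt_id' z).const_mul b₁)).add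
        ((hasDerivAt_pow 2 z).const_mul b₂)).add ((hasDerivAt_pow 3 z).const_mul b₃)).add
        ((hasDerivAt_pow 4 z).mul hkz))
    have h2 : G =ᶠ[𝓝 z] h := by
      filter_upwards [Metric.isOpen_ball.mem_nhds hz, isOpen_ne.mem_nhds hz0] with w hw hw0
      exact hG w hw hw0
    refine (h1.congr_of_eventuallyEq h2).congr_deriv ?_
    push_cast
    ring
  have hq : DifferentiableOn ℂ (fun z => 4 * k z + z * deriv k z) (Metric.ball 0 1) := by
    have := hk.deriv Metric.isOpen_ball
    fun_prop
  have hlow := annulus_lintegral_ge (J := fun z => ‖deriv G z‖ ^ 2)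
    ((measurable_deriv G).norm.pow_const 2) hε (r := r) fun t ht =>
      circle_lintegral_deriv_sq_ge hq (fun z hz hz0 => (hder z hz hz0).deriv) (hε.trans ht.1)
        (ht.2.trans_le hr1)
  rw [lintegral_radial hε hεr (sq_nonneg _) (sq_nonneg _) (sq_nonneg _)] at hlow
  have hA0 : ∀ z ∈ A, z ∈ Metric.ball (0 : ℂ) 1 ∧ z ≠ 0 := fun z hz =>
    ⟨hball1 z (hz.2.trans_le hr1), norm_pos_iff.1 (hε.trans hz.1)⟩
  have hup := lintegral_deriv_sq_le hA
    (fun z hz => (hder z (hA0 z hz).1 (hA0 z hz).2).differentiableAt)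
    (hinj.mono hA0) hβ hρ (fun z hz => hball z hz.1 hz.2)
  have hβ2 : 0 ≤ 1 - ‖β‖ ^ 2 := by nlinarith [norm_nonneg β]
  have := (mul_le_mul_right hlow (ENNReal.ofReal (1 - ‖β‖ ^ 2))).trans hup
  rw [← ENNReal.ofReal_mul hβ2, ENNReal.ofReal_le_ofReal_iff (by positivity)] at this
  refine le_of_mul_le_mul_left ?_ pi_pos
  linarith

/-- **Area theorem** (first three terms) for univalent functions `1/z + b₁ z + b₂ z² + ⋯` in the
punctured unit disk. -/
theorem area_inequality {G k : ℂ → ℂ} {b₁ b₂ b₃ : ℂ}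
    (hk : DifferentiableOn ℂ k (Metric.ball 0 1))
    (hG : ∀ z ∈ Metric.ball (0 : ℂ) 1, z ≠ 0 →
      G z = z⁻¹ + b₁ * z + b₂ * z ^ 2 + b₃ * z ^ 3 + z ^ 4 * k z)
    (hinj : InjOn G (Metric.ball 0 1 \ {0})) :
    ‖b₁‖ ^ 2 + 2 * ‖b₂‖ ^ 2 + 3 * ‖b₃‖ ^ 2 ≤ 1 := by
  have hr : ∀ r ∈ Ioo (0 : ℝ) 1,
      ‖b₁‖ ^ 2 * r ^ 2 + 2 * ‖b₂‖ ^ 2 * r ^ 4 + 3 * ‖b₃‖ ^ 2 * r ^ 6 ≤ (r ^ 2)⁻¹ := by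
    rintro r ⟨hr0, hr1⟩
    let m : ℂ → ℂ := fun z => b₂ + b₃ * z + z ^ 2 * k z
    have hm : ContinuousOn m (Metric.closedBall 0 r) := by
      have := hk.continuousOn.mono (Metric.closedBall_subset_ball hr1)
      fun_prop
    obtain ⟨K, hK⟩ := (isCompact_closedBall (0 : ℂ) r).exists_bound_of_continuousOn hm
    have hK0 : 0 ≤ K := (norm_nonneg _).trans (hK 0 (by simp [hr0.le]))
    set B := ‖b₁‖ with hB
    have hB0 : 0 ≤ B := norm_nonneg _
    set C := 4 * K + B * (B + K)
    let P : ℝ → ℝ := fun ε => -(r ^ 2)⁻¹ + B ^ 2 * (r ^ 2 - ε ^ 2) +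
      2 * ‖b₂‖ ^ 2 * (r ^ 4 - ε ^ 4) + 3 * ‖b₃‖ ^ 2 * (r ^ 6 - ε ^ 6)
    -- Lower bound minus upper bound, with the singular terms `ε⁻²` cancelled, so that `N` is
    -- continuous at `0`.
    let N : ℝ → ℝ := fun ε =>
      P ε - B ^ 2 * ε ^ 2 - B ^ 2 * ε ^ 4 * P ε - 2 * C * ε - C ^ 2 * ε ^ 4
    have hsmall : ∀ c : ℝ, ∀ᶠ ε : ℝ in 𝓝[>] 0, c * ε ≤ 1 := fun c => by
      have : Tendsto (fun ε : ℝ => c * ε) (𝓝[>] 0) (𝓝 (c * 0)) :=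
        (Continuous.tendsto (by fun_prop) 0).mono_left nhdsWithin_le_nhds
      rw [mul_zero] at this
      exact this.eventually_le_const one_pos
    have hN : ∀ᶠ ε : ℝ in 𝓝[>] 0, N ε ≤ 0 := by
      filter_upwards [self_mem_nhdsWithin, hsmall 1, hsmall r⁻¹, hsmall (3 * B),
        hsmall (2 * (B + K + B * (B + K)))] with ε hε hε1 hεr h1 h2
      replace hε : 0 < ε := hε
      rw [one_mul] at hε1
      replace hεr : ε ≤ r := by rwa [inv_mul_le_iff₀ hr0, mul_one] at hεr
      have hβn : ‖-b₁ * (ε : ℂ) ^ 2‖ = B * ε ^ 2 := by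
        rw [norm_mul, norm_neg, norm_pow, Complex.norm_real, Real.norm_of_nonneg hε.le]
      have hβ : ‖-b₁ * (ε : ℂ) ^ 2‖ < 1 := by rw [hβn]; nlinarith [mul_nonneg hB0 hε.le]
      have := area_inequality_annulus hk hG hinj hε hεr hr1.le hβ
        (ρ := ε⁻¹ + C * ε ^ 2) (by positivity) fun z hz hzr =>
          norm_add_mul_conj_le (m := m) hr1.le
            (fun z hz hz0 => by rw [hG z hz hz0]; simp only [m]; ring)
            hK hε hε1 hK0 h1 h2 hz hzr
      rw [hβn] at this
      have e : N ε = (1 - (B * ε ^ 2) ^ 2) * ((ε ^ 2)⁻¹ - (r ^ 2)⁻¹ + B ^ 2 * (r ^ 2 - ε ^ 2) +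
          2 * ‖b₂‖ ^ 2 * (r ^ 4 - ε ^ 4) + 3 * ‖b₃‖ ^ 2 * (r ^ 6 - ε ^ 6)) -
          (ε⁻¹ + C * ε ^ 2) ^ 2 := by
        simp only [N, P]
        field_simp
        ring
      rw [e]; linarith
    have hNc : Tendsto N (𝓝[>] 0) (𝓝 (N 0)) :=
      (Continuous.tendsto (by fun_prop) 0).mono_left nhdsWithin_le_nhds
    have := le_of_tendsto hNc hN
    simp only [N, P] at this
    norm_num at this
    linarith
  have h1 : Tendsto (fun r : ℝ => ‖b₁‖ ^ 2 * r ^ 2 + 2 * ‖b₂‖ ^ 2 * r ^ 4 + 3 * ‖b₃‖ ^ 2 * r ^ 6)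
      (𝓝[<] 1) (𝓝 (‖b₁‖ ^ 2 * 1 ^ 2 + 2 * ‖b₂‖ ^ 2 * 1 ^ 4 + 3 * ‖b₃‖ ^ 2 * 1 ^ 6)) :=
    (Continuous.tendsto (by fun_prop) 1).mono_left nhdsWithin_le_nhds
  have h2 : Tendsto (fun r : ℝ => (r ^ 2)⁻¹) (𝓝[<] 1) (𝓝 ((1 ^ 2)⁻¹)) :=
    (((continuous_pow 2).tendsto (1 : ℝ)).inv₀ (by norm_num)).mono_left nhdsWithin_le_nhds
  have := le_of_tendsto_of_tendsto h1 h2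
    (by filter_upwards [Ioo_mem_nhdsLT (zero_lt_one' ℝ)] with r h using hr r h)
  simpa using this

/-! ### The Hankel determinant bound. -/

theorem theorem2 (f : ℂ → ℂ) (hf : ClassS f) (ha : taylorCoeff f 2 = 0) :
    AnalyticAt ℂ (diskInverse f) 0 ∧
      ‖hankelTwoThree (diskInverse f)‖ ≤ √3 / (6 * √7) + 2 * √3 := by
  refine ⟨hf.analyticAt_diskInverse, ?_⟩
  obtain ⟨h3, h4, h5⟩ := hf.taylorCoeff_diskInverse ha
  obtain ⟨k, hk, hG⟩ := hf.exists_inv_expansion ha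
  have harea := area_inequality hk hG
    fun x hx y hy hxy => hf.injOn hx.1 hy.1 (inv_injective hxy)
  set b₁ := -taylorCoeff f 3 with hb₁
  set b₂ := -taylorCoeff f 4 with hb₂
  set b₃ := taylorCoeff f 3 ^ 2 - taylorCoeff f 5 with hb₃
  have hH : hankelTwoThree (diskInverse f) = 2 * b₁ ^ 3 + b₁ * b₃ - b₂ ^ 2 := by
    rw [hankelTwoThree, h3, h4, h5, hb₃]
    have : taylorCoeff f 3 = -b₁ := by rw [hb₁, neg_neg]
    rw [this]; ring
  have hb1 : ‖b₁‖ ≤ 1 := by nlinarith [sq_nonneg ‖b₂‖, sq_nonneg ‖b₃‖]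
  have hcube : ‖b₁‖ ^ 3 ≤ 1 := pow_le_one₀ (norm_nonneg _) hb1
  have hle : ‖hankelTwoThree (diskInverse f)‖ ≤ 2 * ‖b₁‖ ^ 3 + ‖b₁‖ * ‖b₃‖ + ‖b₂‖ ^ 2 := by
    rw [hH]
    refine (norm_sub_le _ _).trans ?_
    rw [norm_pow]
    gcongr
    refine (norm_add_le _ _).trans ?_
    simp [norm_pow]
  -- The area inequality and `2|b₁||b₃| ≤ |b₁|² + |b₃|²` give `|b₁||b₃| + |b₂|² ≤ 1/2`; the total
  -- `5/2` is below `3 ≤ 2√3`, so the term `√3/(6√7)` is needed only to be nonnegative.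
  have h32 : (3 / 2 : ℝ) ≤ √3 := Real.le_sqrt_of_sq_le (by norm_num)
  have hpos : 0 ≤ √3 / (6 * √7) := by positivity
  nlinarith [sq_nonneg (‖b₁‖ - ‖b₃‖), sq_nonneg ‖b₃‖]
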